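/- A valued field $(K,v)$ is a field $K$ with a Krull valuation $v$ (value group $vK$ any totally ordered abelian group, residue field $Kv$). A valued field extension $(L|K,w|v)$ is a field extension $L|K$ together with a valuation $w$ on $L$ with $w|_K=v$. For a finite valued field extension put $e(w/v)=(wL:vK)$ and $f(w/v)=[Lw:Kv]$. Fix an extension $\overline w$ of $w$ to an algebraic closure $\overline L=\overline K$ of $L$; for $F\in\{K,L\}$ let $F^h$ be the henselization of $F$ with respect to $\overline w$, that is, the fixed field of $\{\sigma\in \mathrm{Gal}(F^{\mathrm{sep}}|F) : \overline w\circ\sigma=\overline w \text{ on } F^{\mathrm{sep}}\}$, where $F^{\mathrm{sep}}$ is the separable closure of $F$ in $\overline L$. The defect of the extension is $$d(w/v)=\frac{[L^h:K^h]}{e(w/v)\,f(w/v)}$$ (it does not depend on the choice of $\overline w$). The extension is called a defect extension if $d(w/v)>1$, defectless if $d(w/v)=1$, and immediate if $wL=vK$ and $Lw=Kv$. A valued field $(K,v)$ is called simply defectless if every valued field extension $(L|K,w|v)$ with $L|K$ simple and algebraic is defectless, and immediate-defectless if no finite valued field extension of $(K,v)$ is both immediate and a defect extension. **Proposition.** If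 a valued field $(K,v)$ is simply defectless, then it is immediate-defectless. -/

import Mathlib

open IntermediateField

/-!
Valuations are written multiplicatively (`Valuation K Γ₀`), and `v.HasExtension w` says that the
restriction of `w` to the base field is equivalent to `v`, i.e. equal to `v` after identifying
the value group of `v` with a subgroup of the value group of `w`.
-/

namespace ValuedDefect

section Henselization

variable (F : Type*) {Ω Γ : Type*} [Field F] [Field Ω] [Algebra F Ω]
  [LinearOrderedCommGroupWithZero Γ] (V : Valuation Ω Γ)

/-- The decomposition group of a valuation `V` on `Ω ⊇ F`: all `σ` in the Galois group over `F`
of the separable closure of `F` in `Ω` with `V ∘ σ = V`. -/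
def decompositionGroup : Subgroup Gal((separableClosure F Ω)/F) where
  carrier := {σ | ∀ x : separableClosure F Ω, V (σ x : Ω) = V (x : Ω)}
  mul_mem' {σ τ} hσ hτ x := (hσ (τ x)).trans (hτ x)
  one_mem' _ := rfl
  inv_mem' {σ} hσ x := by
    have h := hσ (σ⁻¹ x)
    rw [← AlgEquiv.mul_apply, mul_inv_cancel] at h
    exact h.symm

/-- The henselization of `F` inside `Ω` (an algebraic closure of `F`) with respect to the valuation
`V` on `Ω`: the fixed field of the decomposition group. -/
noncomputable def henselization : IntermediateField F Ω :=
  IntermediateField.lift (fixedField (decompositionGroup F V))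

end Henselization

section ExtensionToClosure

variable {L Γ : Type*} [Field L] [LinearOrderedCommGroupWithZero Γ]

theorem exists_extension_closure (w : Valuation L Γ) :
    ∃ B : ValuationSubring (AlgebraicClosure L), w.HasExtension B.valuation := by
  obtain ⟨B, hB, hloc⟩ := IsLocalRing.exists_factor_valuationRing
    ((algebraMap L (AlgebraicClosure L)).comp w.valuationSubring.subtype)
  refine ⟨B, ⟨?_⟩⟩
  rw [Valuation.isEquiv_iff_val_le_one]
  intro x
  rw [Valuation.comap_apply, ValuationSubring.valuation_le_one_iff]
  refine ⟨fun hx => hB ⟨x, hx⟩, fun hx => ?_⟩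
  by_contra hlt
  rw [not_le] at hlt
  have hx0 : x ≠ 0 := by
    rintro rfl
    simp at hlt
  have hy : w x⁻¹ < 1 := by
    rw [map_inv₀]
    exact inv_lt_one_of_one_lt₀ hlt
  have hu : IsUnit (⟨x⁻¹, hy.le⟩ : w.valuationSubring) := by
    apply hloc.map_nonunit
    refine IsUnit.of_mul_eq_one (⟨_, hx⟩ : B) ?_
    apply Subtype.ext
    change algebraMap L (AlgebraicClosure L) x⁻¹ * algebraMap L (AlgebraicClosure L) x = 1
    rw [← map_mul, inv_mul_cancel₀ hx0, map_one]
  have h1 := (Valuation.integer.integers w).one_of_isUnit hu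
  exact hy.ne h1

/-- The valuation ring of a fixed extension of `w` to the algebraic closure. -/
noncomputable def closureRing (w : Valuation L Γ) : ValuationSubring (AlgebraicClosure L) :=
  (exists_extension_closure w).choose

/-- A fixed extension of `w` to the algebraic closure. -/
noncomputable def closureValuation (w : Valuation L Γ) :
    Valuation (AlgebraicClosure L) (closureRing w).ValueGroup :=
  (closureRing w).valuation

end ExtensionToClosure

section Extension

variable {K L Γ₀ Γ₁ : Type*} [Field K] [Field L] [Algebra K L]
  [LinearOrderedCommGroupWithZero Γ₀] [LinearOrderedCommGroupWithZero Γ₁]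

/-- The value group `vK`, for a valuation `v` on a field `K`. -/
abbrev valueGroup (v : Valuation K Γ₀) : Subgroup Γ₀ˣ :=
  MonoidWithZeroHom.valueGroup v.toMonoidWithZeroHom

/-- The residue field `Kv`. -/
abbrev ResField (v : Valuation K Γ₀) : Type _ :=
  IsLocalRing.ResidueField v.valuationSubring

variable (v : Valuation K Γ₀) (w : Valuation L Γ₁)

variable (K) in
/-- The ramification index `(wL : vK)`; here `vK` is seen as the subgroup of `wL` consisting
of the values of the nonzero elements of `K`. -/
noncomputable def ramificationIndex : ℕ :=
  (valueGroup (w.comap (algebraMap K L))).relIndex (valueGroup w)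

/-- The inertia degree `[Lw : Kv]`. -/
noncomputable def inertiaDegree [v.HasExtension w] : ℕ :=
  Module.finrank (ResField v) (ResField w)

/-- The defect `[L^h : K^h] / (e f)` of a finite valued field extension; both henselizations are
formed inside the algebraic closure of `L`, with respect to one extension of `w` to it. -/
noncomputable def defect [v.HasExtension w] : ℚ :=
  (Subfield.relfinrank (henselization K (closureValuation w)).toSubfield
      (henselization L (closureValuation w)).toSubfield : ℚ) /
    ((ramificationIndex K w : ℚ) * (inertiaDegree v w : ℚ))

/-- `w/v` is a defectless extension. -/
def IsDefectlessExtension [v.HasExtension w] : Prop := defect v w = 1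

/-- `w/v` is a defect extension. -/
def IsDefectExtension [v.HasExtension w] : Prop := 1 < defect v w

/-- `w/v` is immediate: `wL = vK` and `Lw = Kv`. -/
def IsImmediate [v.HasExtension w] : Prop :=
  valueGroup (w.comap (algebraMap K L)) = valueGroup w ∧
    Function.Bijective (algebraMap (ResField v) (ResField w))

end Extension

universe u

variable {K : Type u} {Γ₀ : Type*} [Field K] [LinearOrderedCommGroupWithZero Γ₀]

/-- `(K, v)` is simply defectless: all simple algebraic valued field extensions of `(K, v)` are
defectless. -/
def SimplyDefectless (v : Valuation K Γ₀) : Prop :=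
  ∀ (L Γ₁ : Type u) [Field L] [Algebra K L] [LinearOrderedCommGroupWithZero Γ₁]
    (w : Valuation L Γ₁) [v.HasExtension w],
    Algebra.IsAlgebraic K L → (∃ x : L, K⟮x⟯ = ⊤) → IsDefectlessExtension v w

/-- `(K, v)` is immediate-defectless: no finite valued field extension of `(K, v)` is both
immediate and a defect extension. -/
def ImmediateDefectless (v : Valuation K Γ₀) : Prop :=
  ∀ (L Γ₁ : Type u) [Field L] [Algebra K L] [LinearOrderedCommGroupWithZero Γ₁]
    (w : Valuation L Γ₁) [v.HasExtension w],
    FiniteDimensional K L → IsImmediate v w → ¬ IsDefectExtension v w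

end ValuedDefect

/-! For an immediate extension `e = f = 1`, so being defectless means `L^h ≤ K^h`, equivalently `L ⊆
K^h`. This can be tested one element `a` at a time: `K⟮a⟯` is again immediate over `K`, hence
defectless, hence contained in `K^h`. The difficulty is that `K^h` for `K⟮a⟯` and for `L` is formed
in different algebraic closures with unrelated extensions of the valuation.
`forall_mem_henselization_of_isEquiv` bridges this, using conjugacy of valuation rings in a possibly
infinite Galois extension (`exists_conj_of_comap_eq`). -/

namespace ValuationSubring

/-! ### Conjugacy of valuation rings in Galois extensions -/

variable {E S : Type*} [Field E] [Field S] [Algebra E S]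

/-- The integral closure of `O` is integrally closed in `S`, so any element outside it is missed by
some valuation ring containing it. -/
theorem isIntegral_of_forall_mem {O : ValuationSubring E} {x : S}
    (h : ∀ W : ValuationSubring S, O ≤ W.comap (algebraMap E S) → x ∈ W) : IsIntegral O x := by
  by_contra hx
  have hx' : x ∉ (integralClosure O S).toSubring := hx
  have : IsIntegrallyClosedIn (integralClosure O S).toSubring S :=
    inferInstanceAs (IsIntegrallyClosedIn (integralClosure O S) S)
  obtain ⟨W, hW, hxW⟩ := Subring.exists_le_valuationSubring_of_isIntegrallyClosedIn hx'
  exact hxW (h W fun o ho => hW (isIntegral_algebraMap (R := O) (x := ⟨o, ho⟩)))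

theorem mem_of_isIntegral_comap {A : ValuationSubring S} {x : S}
    (hx : IsIntegral (A.comap (algebraMap E S)) x) : x ∈ A := by
  let f : A.comap (algebraMap E S) →+* A :=
    ((algebraMap E S).comp (A.comap (algebraMap E S)).subtype).codRestrict A.toSubring
      fun o => o.2
  have h : IsIntegral A x := by
    obtain ⟨p, hp, hpx⟩ := hx
    refine ⟨p.map f, hp.map f, ?_⟩
    rw [Polynomial.eval₂_map]
    exact hpx
  obtain ⟨y, rfl⟩ := IsIntegrallyClosed.isIntegral_iff.mp h
  exact y.2

/-- An element of a valuation ring `A` of an algebraic extension is a quotient of two integral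
elements whose denominator is a unit of `A`. -/
theorem exists_integral_fraction [Algebra.IsAlgebraic E S] (A : ValuationSubring S) {x : S}
    (hx : x ∈ A) :
    ∃ y z : S, IsIntegral (A.comap (algebraMap E S)) y ∧
      IsIntegral (A.comap (algebraMap E S)) z ∧ A.valuation z = 1 ∧ x * z = y := by
  by_cases hx0 : x = 0
  · exact ⟨0, 1, isIntegral_zero, isIntegral_one, map_one _, by simp [hx0]⟩
  obtain ⟨p, hp0, hpx⟩ := Algebra.IsAlgebraic.isAlgebraic (R := E) x
  let u : ℕ → A.ValueGroup := fun i => A.valuation (algebraMap E S (p.coeff i))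
  -- The lexicographic order selects the largest index among the coefficients of maximal value;
  -- after division by that coefficient, all later ones have value `< 1`.
  obtain ⟨j, hj, hmax⟩ := (Finset.range (p.natDegree + 1)).exists_max_image
    (fun i => toLex (u i, i)) ⟨0, by simp⟩
  simp only [Prod.Lex.toLex_le_toLex, Finset.mem_range] at hmax hj
  have huj : u j ≠ 0 := by
    intro h0
    have h1 := hmax p.natDegree (by omega)
    have h2 : u p.natDegree ≠ 0 := by
      simp [u, hp0]
    rw [h0] at h1
    rcases h1 with h1 | h1
    · exact not_lt_zero h1
    · exact h2 h1.1
  have hpj : algebraMap E S (p.coeff j) ≠ 0 := fun h => huj (by simp [u, h])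
  let c : ℕ → E := fun i => p.coeff i / p.coeff j
  have hcj : c j = 1 := div_self fun h => hpj (by simp [h])
  have hcval (i : ℕ) : A.valuation (algebraMap E S (c i)) = u i / u j := by
    simp [c, u]
  have hc (i : ℕ) (hi : i < p.natDegree + 1) : A.valuation (algebraMap E S (c i)) ≤ 1 := by
    rw [hcval, div_le_one₀ (zero_lt_iff.mpr huj)]
    rcases hmax i hi with h | h
    · exact h.le
    · exact h.1.le
  have hc' (i : ℕ) (hi : i < p.natDegree + 1) (hij : j < i) :
      A.valuation (algebraMap E S (c i)) < 1 := by
    rw [hcval, div_lt_one₀ (zero_lt_iff.mpr huj)]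
    rcases hmax i hi with h | h
    · exact h
    · exact absurd h.2 (by simpa using hij)
  obtain ⟨m, hm⟩ := Nat.exists_eq_add_of_le (Nat.le_of_lt_succ hj)
  have hsum : ∑ i ∈ Finset.range (j + (m + 1)), algebraMap E S (c i) * x ^ i = 0 := by
    have h1 : ∑ i ∈ Finset.range (p.natDegree + 1), algebraMap E S (p.coeff i) * x ^ i = 0 := by
      rw [← hpx, Polynomial.aeval_eq_sum_range]
      simp [Algebra.smul_def]
    rw [hm, add_assoc] at h1
    have h2 : ∀ i, algebraMap E S (c i) * x ^ i =
        (algebraMap E S (p.coeff j))⁻¹ * (algebraMap E S (p.coeff i) * x ^ i) := by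
      intro i
      simp only [c, map_div₀]
      ring
    simp_rw [h2]
    rw [← Finset.mul_sum, h1, mul_zero]
  rw [Finset.sum_range_add] at hsum
  -- The relation for `x` is split at `j` and divided by `x ^ (j - 1)`: `z` is a polynomial in `x`,
  -- and `y` one in `x⁻¹`.
  let z : S := ∑ k ∈ Finset.range (m + 1), algebraMap E S (c (j + k)) * x ^ k
  let y : S := - ∑ i ∈ Finset.range j, algebraMap E S (c i) * x⁻¹ ^ (j - 1 - i)
  have hxz : x * z = y := by
    have h1 : x ^ j * z = ∑ k ∈ Finset.range (m + 1), algebraMap E S (c (j + k)) * x ^ (j + k) := by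
      simp only [z, Finset.mul_sum]
      exact Finset.sum_congr rfl fun k _ => by ring
    have h2 : x ^ j * y = - (x * ∑ i ∈ Finset.range j, algebraMap E S (c i) * x ^ i) := by
      simp only [y, mul_neg, Finset.mul_sum]
      congr 1
      refine Finset.sum_congr rfl fun i hi => ?_
      have hi' : j = i + 1 + (j - 1 - i) := by
        have := Finset.mem_range.mp hi
        omega
      have h3 : x ^ j * x⁻¹ ^ (j - 1 - i) = x ^ (i + 1) := by
        conv_lhs => rw [hi', pow_add]
        rw [← hi', mul_assoc, ← mul_pow, mul_inv_cancel₀ hx0, one_pow, mul_one]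
      calc _ = algebraMap E S (c i) * (x ^ j * x⁻¹ ^ (j - 1 - i)) := by ring
        _ = _ := by rw [h3]; ring
    apply mul_left_cancel₀ (pow_ne_zero j hx0)
    rw [h2, mul_left_comm, h1, ← mul_neg]
    congr 1
    exact eq_neg_of_add_eq_zero_right hsum
  have hmem (W : ValuationSubring S)
      (hW : A.comap (algebraMap E S) ≤ W.comap (algebraMap E S)) : y ∈ W ∧ z ∈ W := by
    have hcW (i : ℕ) (hi : i < p.natDegree + 1) : algebraMap E S (c i) ∈ W :=
      hW ((A.valuation_le_one_iff _).mp (hc i hi))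
    -- If `x ∈ W` then `z ∈ W`, and if `x⁻¹ ∈ W` then `y ∈ W`; `x * z = y` gives the other.
    rcases W.mem_or_inv_mem x with h | h
    · have hz : z ∈ W := sum_mem fun k hk => W.mul_mem _ _
        (hcW _ (by have := Finset.mem_range.mp hk; omega)) (pow_mem h _)
      exact ⟨hxz ▸ W.mul_mem _ _ h hz, hz⟩
    · have hy : y ∈ W := W.neg_mem _ <| sum_mem fun i hi => W.mul_mem _ _
        (hcW _ (by have := Finset.mem_range.mp hi; omega)) (pow_mem h _)
      refine ⟨hy, ?_⟩
      have : z = x⁻¹ * y := by rw [← hxz, inv_mul_cancel_left₀ hx0]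
      exact this ▸ W.mul_mem _ _ h hy
  refine ⟨y, z, isIntegral_of_forall_mem fun W hW => (hmem W hW).1,
    isIntegral_of_forall_mem fun W hW => (hmem W hW).2, ?_, hxz⟩
  simp only [z]
  rw [Finset.sum_range_succ', add_zero, hcj, map_one, pow_zero, one_mul, add_comm]
  apply Valuation.map_one_add_of_lt
  refine A.valuation.map_sum_lt one_ne_zero fun k hk => ?_
  rw [map_mul, map_pow]
  have := Finset.mem_range.mp hk
  exact mul_lt_one_of_lt_of_le (hc' _ (by omega) (by omega))
    (pow_le_one₀ zero_le ((A.valuation_le_one_iff x).mpr hx))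

/-- Valuation rings of an algebraic extension with the same centre on the integral closure are
comparable. -/
theorem le_of_forall_integral [Algebra.IsAlgebraic E S] {A B : ValuationSubring S}
    (h : A.comap (algebraMap E S) = B.comap (algebraMap E S))
    (hz : ∀ z : S, IsIntegral (A.comap (algebraMap E S)) z → B.valuation z < 1 →
      A.valuation z < 1) : A ≤ B := by
  intro x hx
  obtain ⟨y, z, hy, hzi, hz1, rfl⟩ := exists_integral_fraction (E := E) A hx
  have hzB : B.valuation z = 1 := by
    refine le_antisymm ((B.valuation_le_one_iff z).mpr ?_) (not_lt.mp fun hlt => ?_)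
    · exact mem_of_isIntegral_comap (E := E) (h ▸ hzi)
    · exact (hz z hzi hlt).ne hz1
  have hyB := (B.valuation_le_one_iff _).mpr (mem_of_isIntegral_comap (E := E) (h ▸ hy))
  rwa [map_mul, hzB, mul_one, B.valuation_le_one_iff] at hyB

instance isInvariant_integralClosure [IsGalois E S] (O : ValuationSubring E) :
    Algebra.IsInvariant O (integralClosure O S) Gal(S/E) where
  isInvariant b hb := by
    have h1 : (b : S) ∈ (⊥ : IntermediateField E S) :=
      (InfiniteGalois.mem_bot_iff_fixed _).mpr fun g => congrArg Subtype.val (hb g)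
    obtain ⟨e, he⟩ := IntermediateField.mem_bot.mp h1
    have h2 : IsIntegral O e := by
      have := b.2
      rw [mem_integralClosure_iff, ← he] at this
      exact (isIntegral_algebraMap_iff (algebraMap E S).injective).mp this
    obtain ⟨a, rfl⟩ := IsIntegrallyClosed.isIntegral_iff.mp h2
    exact ⟨a, Subtype.ext he⟩

/-- The centre of a valuation ring on the integral closure of its trace. -/
noncomputable def centre (E : Type*) [Field E] [Algebra E S] (O : ValuationSubring E)
    (A : ValuationSubring S) (h : O = A.comap (algebraMap E S)) :
    Ideal (integralClosure O S) :=
  (IsLocalRing.maximalIdeal A).comap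
    ((algebraMap (integralClosure O S) S).codRestrict A.toSubring
      fun z => mem_of_isIntegral_comap (E := E) (h ▸ z.2))

theorem mem_centre {O : ValuationSubring E} {A : ValuationSubring S}
    {h : O = A.comap (algebraMap E S)} {z : integralClosure O S} :
    z ∈ centre E O A h ↔ A.valuation (z : S) < 1 := by
  rw [centre, Ideal.mem_comap]
  exact A.valuation_lt_one_iff _

instance (O : ValuationSubring E) (A : ValuationSubring S) (h : O = A.comap (algebraMap E S)) :
    (centre E O A h).IsPrime := by
  unfold centre
  exact Ideal.comap_isPrime _ _

/-- The extensions of a valuation ring to a Galois extension are conjugate. -/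
theorem exists_conj_of_comap_eq [IsGalois E S] {A B : ValuationSubring S}
    (h : A.comap (algebraMap E S) = B.comap (algebraMap E S)) :
    ∃ g : Gal(S/E), ∀ x, x ∈ A ↔ g x ∈ B := by
  obtain ⟨O, hO⟩ : ∃ O, O = A.comap (algebraMap E S) := ⟨_, rfl⟩
  -- Conjugacy of primes under a profinite group needs a continuous action on a discrete ring;
  -- stabilizers are open because elements are algebraic.
  let _ : TopologicalSpace (integralClosure O S) := ⊥
  have : DiscreteTopology (integralClosure O S) := ⟨rfl⟩
  have : ContinuousSMul Gal(S/E) (integralClosure O S) := by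
    rw [continuousSMul_iff_stabilizer_isOpen]
    intro z
    convert! stabilizer_isOpen_of_isIntegral (K := E) (z : S) using 1
    ext g
    exact Subtype.ext_iff
  obtain ⟨g, hg⟩ := Algebra.IsInvariant.exists_smul_of_under_eq_of_profinite (G := Gal(S/E))
    (A := O) (centre E O A hO) (centre E O B (hO.trans h)) (by
      ext o
      rw [Ideal.under, Ideal.mem_comap, Ideal.mem_comap, mem_centre, mem_centre]
      change A.valuation.comap (algebraMap E S) _ < 1 ↔ B.valuation.comap (algebraMap E S) _ < 1
      have : (A.valuation.comap (algebraMap E S)).IsEquiv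
          (B.valuation.comap (algebraMap E S)) := by
        rw [Valuation.isEquiv_iff_val_le_one]
        intro x
        rw [Valuation.comap_apply, Valuation.comap_apply, valuation_le_one_iff,
          valuation_le_one_iff]
        exact SetLike.ext_iff.mp h x
      exact this.lt_one_iff_lt_one)
  have hcoe (z : S) (hz : IsIntegral O z) : B.valuation (g z) < 1 ↔ A.valuation z < 1 := by
    have h1 : g • (⟨z, hz⟩ : integralClosure O S) ∈ centre E O B (hO.trans h) ↔
        (⟨z, hz⟩ : integralClosure O S) ∈ centre E O A hO := by
      rw [hg, Ideal.smul_mem_pointwise_smul_iff]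
    rwa [mem_centre, mem_centre] at h1
  let B' : ValuationSubring S := B.comap (g : S →+* S)
  have hval (z : S) : B'.valuation z < 1 ↔ B.valuation (g z) < 1 := by
    have : B'.valuation.IsEquiv (B.valuation.comap (g : S →+* S)) := by
      rw [Valuation.isEquiv_iff_val_le_one]
      intro x
      rw [Valuation.comap_apply, valuation_le_one_iff, valuation_le_one_iff]
      exact Iff.rfl
    exact this.lt_one_iff_lt_one
  have hB' : B'.comap (algebraMap E S) = B.comap (algebraMap E S) := by
    ext e
    simp [B', mem_comap]
  -- `A` and the pullback `B'` of `B` along `g` have the same centre, hence are equal.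
  have hAB : A = B' := by
    refine le_antisymm (le_of_forall_integral (E := E) (h.trans hB'.symm) fun z hz hlt => ?_)
      (le_of_forall_integral (E := E) (h.trans hB'.symm).symm fun z hz hlt => ?_)
    · exact (hcoe z (hO ▸ hz)).mp ((hval z).mp hlt)
    · exact (hval z).mpr ((hcoe z (by rwa [hO, h, ← hB'])).mpr hlt)
  refine ⟨g, fun x => ?_⟩
  conv_lhs => rw [hAB]
  exact Iff.rfl

end ValuationSubring

namespace ValuedDefect

/-! ### Membership in the henselization -/

section Henselization

variable {F Ω Γ : Type*} [Field F] [Field Ω] [Algebra F Ω]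
  [LinearOrderedCommGroupWithZero Γ] {V : Valuation Ω Γ}

theorem coe_mem_henselization_iff {x : separableClosure F Ω} :
    (x : Ω) ∈ henselization F V ↔
      ∀ σ : Gal((separableClosure F Ω)/F),
        (∀ y : separableClosure F Ω, V (σ y : Ω) = V (y : Ω)) → σ x = x := by
  rw [henselization, mem_lift, mem_fixedField_iff]
  rfl

theorem isSeparable_of_mem_henselization {x : Ω} (hx : x ∈ henselization F V) :
    IsSeparable F x :=
  mem_separableClosure_iff.mp (lift_le _ hx)

end Henselization

/-! ### Extensions contained in the henselization -/

section Tower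

variable {K E Ω Γ : Type*} [Field K] [Field E] [Field Ω] [Algebra K E] [Algebra K Ω] [Algebra E Ω]
  [IsScalarTower K E Ω] [LinearOrderedCommGroupWithZero Γ] {V : Valuation Ω Γ}

theorem isSeparable_of_forall_mem_henselization
    (h : ∀ e : E, algebraMap E Ω e ∈ henselization K V) : Algebra.IsSeparable K E where
  isSeparable' e := by
    have := isSeparable_of_mem_henselization (h e)
    rwa [IsSeparable, minpoly.algebraMap_eq (algebraMap E Ω).injective] at this

/-- `E` is separable over `K`, so both separable closures in `Ω` coincide, and the decomposition
group over `K` fixes `E`, hence acts `E`-linearly. -/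
theorem henselization_le_of_forall_mem
    (h : ∀ e : E, algebraMap E Ω e ∈ henselization K V) :
    (henselization E V).toSubfield ≤ (henselization K V).toSubfield := by
  have := isSeparable_of_forall_mem_henselization h
  have hsep {x : Ω} : x ∈ separableClosure E Ω ↔ x ∈ separableClosure K Ω := by
    rw [mem_separableClosure_iff, mem_separableClosure_iff]
    exact ⟨IsSeparable.of_algebra_isSeparable_of_isSeparable K, IsSeparable.tower_top E⟩
  let ι : separableClosure E Ω ≃+* separableClosure K Ω :=
    { toFun := fun x => ⟨x, hsep.mp x.2⟩
      invFun := fun x => ⟨x, hsep.mpr x.2⟩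
      left_inv := fun _ => rfl
      right_inv := fun _ => rfl
      map_mul' := fun _ _ => rfl
      map_add' := fun _ _ => rfl }
  intro x hx
  lift x to separableClosure E Ω using lift_le _ hx
  refine (coe_mem_henselization_iff (x := ι x)).mpr fun σ hσ => ?_
  let τ : Gal((separableClosure E Ω)/E) :=
    { (ι.trans σ.toRingEquiv).trans ι.symm with
      commutes' := fun e => by
        have h1 := (coe_mem_henselization_iff
          (x := ι (algebraMap E (separableClosure E Ω) e))).mp (h e) σ hσ
        change ι.symm (σ (ι _)) = _
        rw [h1, RingEquiv.symm_apply_apply] }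
  have h2 := coe_mem_henselization_iff.mp hx τ fun y => hσ (ι y)
  exact congrArg ι h2

/-- Whether `E` lies in the henselization of `K` only depends on the restriction to `E` of the
chosen valuation on an algebraic closure. -/
theorem forall_mem_henselization_of_isEquiv {Ω' Γ' : Type*} [Field Ω'] [Algebra K Ω']
    [Algebra E Ω'] [IsScalarTower K E Ω'] [IsAlgClosure E Ω] [IsAlgClosure E Ω']
    [LinearOrderedCommGroupWithZero Γ'] {V' : Valuation Ω' Γ'}
    [Algebra.IsAlgebraic K E]
    (hVV' : (V'.comap (algebraMap E Ω')).IsEquiv (V.comap (algebraMap E Ω)))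
    (h : ∀ e : E, algebraMap E Ω' e ∈ henselization K V') (e : E) :
    algebraMap E Ω e ∈ henselization K V := by
  have := isSeparable_of_forall_mem_henselization h
  have : IsAlgClosed Ω := IsAlgClosure.isAlgClosed E
  have : Algebra.IsAlgebraic E Ω := IsAlgClosure.isAlgebraic
  have : Algebra.IsAlgebraic K Ω := Algebra.IsAlgebraic.trans K E Ω
  have : IsAlgClosure K Ω := ⟨inferInstance, inferInstance⟩
  have hsep (e : E) : algebraMap E Ω e ∈ separableClosure K Ω :=
    mem_separableClosure_iff.mpr
      (IsSeparable.of_algebra_isSeparable_of_isSeparable K (isSeparable_algebraMap e))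
  let _ : Algebra E (separableClosure K Ω) :=
    ((algebraMap E Ω).codRestrict (separableClosure K Ω) hsep).toAlgebra
  have : IsScalarTower K E (separableClosure K Ω) :=
    IsScalarTower.of_algebraMap_eq fun k => Subtype.ext (IsScalarTower.algebraMap_apply K E Ω k)
  have : IsGalois E (separableClosure K Ω) := IsGalois.tower_top_of_isGalois K E _
  let φ₀ : Ω' ≃ₐ[E] Ω := IsAlgClosure.equiv E Ω' Ω
  let φ : separableClosure K Ω' ≃ₐ[K] separableClosure K Ω :=
    separableClosure.algEquivOfAlgEquiv (φ₀.restrictScalars K)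
  have hφ (y) : (φ y : Ω) = φ₀ y := rfl
  let V₁ : Valuation (separableClosure K Ω) Γ := V.comap (algebraMap (separableClosure K Ω) Ω)
  let V₂ : Valuation (separableClosure K Ω) Γ' :=
    V'.comap ((algebraMap (separableClosure K Ω') Ω').comp (φ.symm : _ →+* _))
  have hφe (e : E) : ((φ.symm (algebraMap E (separableClosure K Ω) e) :
      separableClosure K Ω') : Ω') = algebraMap E Ω' e := by
    apply φ₀.injective
    rw [← hφ, AlgEquiv.apply_symm_apply, AlgEquiv.commutes]
    rfl
  -- `V₁` and `V₂` have the same valuation ring on `E`, so some `g` fixing `E` conjugates them.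
  obtain ⟨g, hg⟩ := ValuationSubring.exists_conj_of_comap_eq (E := E)
    (A := V₂.valuationSubring) (B := V₁.valuationSubring) (by
      ext e
      rw [ValuationSubring.mem_comap, ValuationSubring.mem_comap,
        Valuation.mem_valuationSubring_iff, Valuation.mem_valuationSubring_iff]
      change V' (φ.symm _ : separableClosure K Ω') ≤ 1 ↔ V (algebraMap E Ω e) ≤ 1
      rw [hφe]
      exact (Valuation.isEquiv_iff_val_le_one.mp hVV'))
  let ψ : separableClosure K Ω' ≃ₐ[K] separableClosure K Ω := φ.trans (g.restrictScalars K)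
  have hψ : (V'.comap (algebraMap (separableClosure K Ω') Ω')).IsEquiv
      (V₁.comap (ψ : _ →+* separableClosure K Ω)) := by
    rw [Valuation.isEquiv_iff_val_le_one]
    intro y
    have := hg (φ y)
    rw [Valuation.mem_valuationSubring_iff, Valuation.mem_valuationSubring_iff] at this
    change V' (φ.symm (φ y) : separableClosure K Ω') ≤ 1 ↔ _ at this
    rwa [AlgEquiv.symm_apply_apply] at this
  have hψe : ψ.symm (algebraMap E (separableClosure K Ω) e) =
      φ.symm (algebraMap E (separableClosure K Ω) e) := by
    change φ.symm (g.symm _) = _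
    rw [AlgEquiv.commutes]
  refine (coe_mem_henselization_iff (x := algebraMap E (separableClosure K Ω) e)).mpr
    fun σ hσ => ?_
  -- Conjugation by `ψ`, which respects both `E` and the valuations, carries `σ` into the
  -- decomposition group of `V'`.
  let σ' : Gal((separableClosure K Ω')/K) := (ψ.trans σ).trans ψ.symm
  have h1 := (coe_mem_henselization_iff
    (x := ψ.symm (algebraMap E (separableClosure K Ω) e))).mp (by
      rw [hψe, hφe]; exact h e) σ' fun y => by
        refine (hψ.eq_iff (r := σ' y) (s := y)).mpr ?_
        change V₁ (ψ (ψ.symm (σ (ψ y)))) = V₁ (ψ y)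
        rw [AlgEquiv.apply_symm_apply]
        exact hσ _
  change ψ.symm (σ (ψ (ψ.symm _))) = _ at h1
  rwa [AlgEquiv.apply_symm_apply, ψ.symm.injective.eq_iff] at h1

end Tower

/-! ### Immediate extensions -/

section Immediate

variable {K E L Γ₀ Γ₁ : Type*} [Field K] [Field E] [Field L] [Algebra K E] [Algebra K L]
  [Algebra E L] [IsScalarTower K E L]
  [LinearOrderedCommGroupWithZero Γ₀] [LinearOrderedCommGroupWithZero Γ₁]
  (v : Valuation K Γ₀) (w : Valuation L Γ₁) [v.HasExtension w]

instance closureValuation_hasExtension : w.HasExtension (closureValuation w) :=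
  (exists_extension_closure w).choose_spec

instance comap_algebraMap_hasExtension : (w.comap (algebraMap E L)).HasExtension w :=
  ⟨Valuation.IsEquiv.refl⟩

theorem comap_comap_algebraMap :
    (w.comap (algebraMap E L)).comap (algebraMap K E) = w.comap (algebraMap K L) := by
  rw [IsScalarTower.algebraMap_eq K E L]
  rfl

theorem hasExtension_comap : v.HasExtension (w.comap (algebraMap E L)) where
  val_isEquiv_comap := by
    rw [comap_comap_algebraMap]
    exact Valuation.HasExtension.val_isEquiv_comap

variable {v w}

/-- The value group and residue field of `E` are squeezed between those of `K` and `L`, which agree.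
-/
theorem IsImmediate.comap [v.HasExtension (w.comap (algebraMap E L))] (h : IsImmediate v w) :
    IsImmediate v (w.comap (algebraMap E L)) := by
  constructor
  · have h1 : valueGroup (w.comap (algebraMap E L)) ≤ valueGroup w :=
      Subgroup.closure_mono fun γ ⟨x, hx⟩ => ⟨algebraMap E L x, hx⟩
    rw [comap_comap_algebraMap]
    refine le_antisymm ?_ (h1.trans h.1.ge)
    rw [← comap_comap_algebraMap (E := E)]
    exact Subgroup.closure_mono fun γ ⟨x, hx⟩ => ⟨algebraMap K E x, hx⟩
  · refine ⟨RingHom.injective _, ?_⟩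
    have hcomp : (algebraMap (ResField (w.comap (algebraMap E L))) (ResField w)).comp
        (algebraMap (ResField v) (ResField (w.comap (algebraMap E L)))) =
        algebraMap (ResField v) (ResField w) := by
      ext x
      obtain ⟨x, rfl⟩ := IsLocalRing.residue_surjective x
      change IsLocalRing.residue _ _ = IsLocalRing.residue _ _
      congr 1
      apply Subtype.ext
      exact (IsScalarTower.algebraMap_apply K E L x).symm
    intro y
    obtain ⟨x, hx⟩ := h.2.2 (algebraMap _ (ResField w) y)
    refine ⟨x, (algebraMap (ResField (w.comap (algebraMap E L))) (ResField w)).injective ?_⟩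
    rw [← hx, ← hcomp]
    rfl

theorem IsImmediate.defect_eq (h : IsImmediate v w) :
    defect v w = Subfield.relfinrank (henselization K (closureValuation w)).toSubfield
      (henselization L (closureValuation w)).toSubfield := by
  have he : ramificationIndex K w = 1 := by
    rw [ramificationIndex, h.1, Subgroup.relIndex_self]
  have hf : inertiaDegree v w = 1 := Module.finrank_of_bijective_algebraMap h.2
  rw [defect, he, hf]
  simp

theorem IsImmediate.isDefectlessExtension_iff (h : IsImmediate v w) :
    IsDefectlessExtension v w ↔
      ∀ x : L, algebraMap L (AlgebraicClosure L) x ∈ henselization K (closureValuation w) := by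
  rw [IsDefectlessExtension, h.defect_eq, Nat.cast_eq_one, Subfield.relfinrank_eq_one_iff]
  exact ⟨fun hle x => hle (IntermediateField.algebraMap_mem (henselization L (closureValuation w)) x),
    henselization_le_of_forall_mem⟩

end Immediate

end ValuedDefect

theorem mainTheorem2 {K Γ₀ : Type*} [Field K] [LinearOrderedCommGroupWithZero Γ₀]
    (v : Valuation K Γ₀) (h : ValuedDefect.SimplyDefectless v) :
    ValuedDefect.ImmediateDefectless v := by
  intro L Γ₁ _ _ _ w _ _ himm hdef
  refine hdef.ne' (himm.isDefectlessExtension_iff.mpr fun a => ?_)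
  have := ValuedDefect.hasExtension_comap (E := K⟮a⟯) v w
  have h1 := himm.comap.isDefectlessExtension_iff.mp
    (h K⟮a⟯ Γ₁ (w.comap (algebraMap K⟮a⟯ L)) inferInstance
      ⟨AdjoinSimple.gen K a, lift_injective K⟮a⟯ (by simp [lift_top])⟩)
  have : Algebra.IsAlgebraic K⟮a⟯ (AlgebraicClosure L) := Algebra.IsAlgebraic.trans K⟮a⟯ L _
  have : IsAlgClosure K⟮a⟯ (AlgebraicClosure L) := ⟨inferInstance, inferInstance⟩
  -- `h1` lives in the algebraic closure of `K⟮a⟯`; both chosen extensions restrict to equivalent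
  -- valuations on `K⟮a⟯`.
  refine ValuedDefect.forall_mem_henselization_of_isEquiv
    (V := ValuedDefect.closureValuation w) ?_ h1 (AdjoinSimple.gen K a)
  have h2 : (w.comap (algebraMap K⟮a⟯ L)).IsEquiv
      ((ValuedDefect.closureValuation w).comap (algebraMap K⟮a⟯ (AlgebraicClosure L))) := by
    rw [← ValuedDefect.comap_comap_algebraMap (E := L)]
    exact (ValuedDefect.closureValuation_hasExtension w).val_isEquiv_comap.comap _
  exact (ValuedDefect.closureValuation_hasExtension _).val_isEquiv_comap.symm.trans h2
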